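/- Let $k$ be a field of characteristic $0$ with finitely many pairwise commuting derivations $\delta_1,\dots,\delta_n$, let $k\{y_1,\dots,y_l\}$ be the ring of differential polynomials, i.e. the polynomial ring over $k$ in the variables $\theta y_i$, where $\theta$ runs over the monomials $\delta_1^{k_1}\cdots\delta_n^{k_n}$ and $1\le i\le l$, with the induced derivations, and fix a ranking: a total order on the variables $\theta y_i$ with $\theta u\ge u$, and with $\theta u\ge\theta v$ whenever $u\ge v$. For $f\notin k$ let $u_f$ be the highest variable appearing in $f$ (its leader), $d=\deg_{u_f}f$, $u_f^d$ its rank (ranks are compared first by leader, then by degree), $I_f$ the coefficient of $u_f^d$ in $f$ (the initial) and $S_f=\partial f/\partial u_f$ (the separant). A polynomial $f$ is reduced with respect to $g\notin k$ if no proper derivative of $u_g$ appears in $f$ and $\deg_{u_g}f<\deg_{u_g}g$. A set $\mathbb A\subset k\{y_1,\dots,y_l\}\setminus k$ is autoreduced if each of its elements is reduced with respect to all the others; it is then finite and is written $\mathbb A=A_1,\dots,A_p$ in order of increasing rank, and $H_{\mathbb A}=\prod_i I_{A_i}S_{A_i}$. An autoreduced set $A_1,\dots,A_r$ has lower rank than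 $B_1,\dots,B_s$ if there is $m\le r,s$ with $\operatorname{rank}A_i=\operatorname{rank}B_i$ for $i<m$ and $\operatorname{rank}A_m<\operatorname{rank}B_m$, or if $r>s$ and $\operatorname{rank}A_i=\operatorname{rank}B_i$ for all $i\le s$. A characteristic set of an ideal $I$ is an autoreduced subset of $I$ such that no autoreduced subset of $I$ has lower rank. Let $[\mathbb A]$ be the differential ideal generated by $\mathbb A$ and $$[\mathbb A]:H_{\mathbb A}^\infty=\{f : H_{\mathbb A}^m f\in[\mathbb A]\text{ for some } m\ge 0\}.$$ A differential ideal $I$ is characterizable, with characterizing set $\mathbb A$, if $\mathbb A$ is a characteristic set of $I$ and $I=[\mathbb A]:H_{\mathbb A}^\infty$. **Theorem.** Let $\mathbb A$ and $\mathbb B$ be characterizing sets of the characterizable differential ideals $I=[\mathbb A]:H_{\mathbb A}^\infty$ and $J=[\mathbb B]:H_{\mathbb B}^\infty$ of $k\{y_1,\dots,y_l\}$. Then $I=J$ if and only if $\mathbb A\subset J$ and $\mathbb B\subset I$. -/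

import Mathlib

open MvPolynomial

namespace DiffAlg

/-- The differential variables (derivatives) `θ y_i` of the ring `k{y_1, …, y_l}` with `n` commuting
derivations: `⟨i, e⟩` stands for `δ_1 ^ (e 1) ⋯ δ_n ^ (e n) y_i`. -/
@[ext]
structure DVar (n l : ℕ) where
  /-- the differential indeterminate -/
  idx : Fin l
  /-- the exponents of the derivative operator -/
  exp : Fin n → ℕ

/-- The operator `θ = δ_1 ^ (θ 1) ⋯ δ_n ^ (θ n)` applied to a differential variable. -/
def DVar.act {n l : ℕ} (θ : Fin n → ℕ) (v : DVar n l) : DVar n l :=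
  ⟨v.idx, θ + v.exp⟩

/-- The total order on the differential variables is a (differential) ranking. -/
structure IsRanking (n l : ℕ) [LinearOrder (DVar n l)] : Prop where
  le_act : ∀ (θ : Fin n → ℕ) (u : DVar n l), u ≤ u.act θ
  act_le_act : ∀ (θ : Fin n → ℕ) (u v : DVar n l), v ≤ u → v.act θ ≤ u.act θ

/-- The ring of differential polynomials `k{y_1, …, y_l}` as a commutative ring. -/
abbrev DPoly (n l : ℕ) (k : Type*) [CommRing k] : Type _ := MvPolynomial (DVar n l) k

section Derivations

variable {n l : ℕ} {k : Type*} [CommRing k]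

/-- A derivation of `k` applied to the coefficients of a polynomial, as an additive map. -/
noncomputable def coeffAdd {σ : Type*} (d : Derivation ℤ k k) :
    MvPolynomial σ k →+ MvPolynomial σ k where
  toFun f := ∑ m ∈ f.support, monomial m (d (coeff m f))
  map_zero' := by simp
  map_add' f g := by
    classical
    ext m
    simp only [coeff_add, coeff_sum, coeff_monomial, Finset.sum_ite_eq', mem_support_iff]
    by_cases hf : coeff m f = 0 <;> by_cases hg : coeff m g = 0 <;>
      by_cases hs : coeff m f + coeff m g = 0 <;> simp_all [← map_add]

theorem coeff_coeffAdd {σ : Type*} (d : Derivation ℤ k k) (f : MvPolynomial σ k) (m : σ →₀ ℕ) :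
    coeff m (coeffAdd d f) = d (coeff m f) := by
  classical
  simp only [coeffAdd, AddMonoidHom.coe_mk, ZeroHom.coe_mk, coeff_sum, coeff_monomial,
    Finset.sum_ite_eq', mem_support_iff]
  by_cases hf : coeff m f = 0 <;> simp_all

theorem coeffAdd_monomial {σ : Type*} (d : Derivation ℤ k k) (m : σ →₀ ℕ) (a : k) :
    coeffAdd d (monomial m a) = monomial m (d a) := by
  classical
  ext m'
  rw [coeff_coeffAdd, coeff_monomial, coeff_monomial]
  split_ifs <;> simp

/-- The derivation of a polynomial ring that applies a derivation of `k` to the coefficients. -/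
noncomputable def coeffDer {σ : Type*} (d : Derivation ℤ k k) :
    Derivation ℤ (MvPolynomial σ k) (MvPolynomial σ k) :=
  Derivation.mk' (coeffAdd d).toIntLinearMap (by
    intro p q
    simp only [AddMonoidHom.coe_toIntLinearMap, smul_eq_mul]
    induction p using MvPolynomial.induction_on' with
    | add p₁ p₂ h₁ h₂ => simp only [add_mul, mul_add, map_add, h₁, h₂]; ring
    | monomial u a =>
      induction q using MvPolynomial.induction_on' with
      | add q₁ q₂ h₁ h₂ => simp only [add_mul, mul_add, map_add, h₁, h₂]; ring
      | monomial v b =>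
        simp only [monomial_mul, coeffAdd_monomial, Derivation.leibniz, smul_eq_mul, map_add,
          add_comm v u])

/-- The `j`-th derivation of `k{y_1, …, y_l}`: it extends `δ j` and maps `θ y_i` to `δ_j θ y_i`. -/
noncomputable def polyDer (δ : Fin n → Derivation ℤ k k) (j : Fin n) :
    Derivation ℤ (DPoly n l k) (DPoly n l k) :=
  coeffDer (δ j) + (mkDerivation k fun v : DVar n l => (X (v.act (Pi.single j 1)) : DPoly n l k)
    ).restrictScalars ℤ

theorem polyDer_C (δ : Fin n → Derivation ℤ k k) (j : Fin n) (a : k) :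
    polyDer (l := l) δ j (C a) = C (δ j a) := by
  simp [polyDer, coeffDer, ← monomial_zero', coeffAdd_monomial, mkDerivation_monomial]

theorem polyDer_X (δ : Fin n → Derivation ℤ k k) (j : Fin n) (v : DVar n l) :
    polyDer δ j (X v) = X (v.act (Pi.single j 1)) := by
  have h : coeffAdd (δ j) (X v : DPoly n l k) = 0 := by
    rw [X, coeffAdd_monomial]; simp
  simp [polyDer, coeffDer, h, mkDerivation_X]

/-- Differential ideals of `k{y_1, …, y_l}`. -/
def IsDifferentialIdeal (δ : Fin n → Derivation ℤ k k) (I : Ideal (DPoly n l k)) : Prop :=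
  ∀ j : Fin n, ∀ f ∈ I, polyDer δ j f ∈ I

/-- The differential ideal `[F]` generated by `F`. -/
noncomputable def diffIdeal (δ : Fin n → Derivation ℤ k k) (F : Set (DPoly n l k)) :
    Ideal (DPoly n l k) :=
  sInf {I | IsDifferentialIdeal δ I ∧ F ⊆ I}

end Derivations

/-- The saturated ideal `I : S = {a | ∃ s ∈ S, s * a ∈ I}` for a multiplicative set `S`. -/
def saturate {R : Type*} [CommRing R] (I : Ideal R) (S : Submonoid R) : Ideal R where
  carrier := {a | ∃ s ∈ S, s * a ∈ I}
  zero_mem' := ⟨1, S.one_mem, by simp⟩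
  add_mem' := by
    rintro a b ⟨s, hs, ha⟩ ⟨t, ht, hb⟩
    refine ⟨s * t, S.mul_mem hs ht, ?_⟩
    have h : s * t * (a + b) = t * (s * a) + s * (t * b) := by ring
    rw [h]
    exact I.add_mem (I.mul_mem_left _ ha) (I.mul_mem_left _ hb)
  smul_mem' := by
    rintro c a ⟨s, hs, ha⟩
    refine ⟨s, hs, ?_⟩
    have h : s * (c • a) = c * (s * a) := by rw [smul_eq_mul]; ring
    rw [h]
    exact I.mul_mem_left _ ha

section Reduction

variable {n l : ℕ} [LinearOrder (DVar n l)] {k : Type*} [CommRing k]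

/-- The leader `u_f`: the highest variable that appears in `f` (`⊥` if `f` is constant). -/
noncomputable def leader (f : DPoly n l k) : WithBot (DVar n l) := f.vars.max

/-- The degree of `f` in its leader (`0` if `f` is constant). -/
noncomputable def leaderDegree (f : DPoly n l k) : ℕ :=
  if h : f.vars.Nonempty then degreeOf (f.vars.max' h) f else 0

/-- The rank `u_f ^ d` of `f`, as the pair `(u_f, d)`; ranks are compared lexicographically. -/
noncomputable def rank (f : DPoly n l k) : WithBot (DVar n l) ×ₗ ℕ :=
  toLex (leader f, leaderDegree f)

/-- The coefficient of `v ^ d` in `f`, where `f` is written as a univariate polynomial in `v`. -/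
noncomputable def coeffIn (v : DVar n l) (d : ℕ) (f : DPoly n l k) : DPoly n l k :=
  ∑ m ∈ f.support with m v = d, monomial (m.erase v) (coeff m f)

/-- The initial `I_f`: the leading coefficient of `f` in its leader (used for nonconstant `f`). -/
noncomputable def initial (f : DPoly n l k) : DPoly n l k :=
  if h : f.vars.Nonempty then coeffIn (f.vars.max' h) (leaderDegree f) f else f

/-- The separant `S_f = ∂f/∂u_f` (used for nonconstant `f`). -/
noncomputable def separant (f : DPoly n l k) : DPoly n l k :=
  if h : f.vars.Nonempty then pderiv (f.vars.max' h) f else 0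

/-- `f` is partially reduced w.r.t. `g`: no proper derivative of `u_g` appears in `f`. -/
def IsPartiallyReduced (f g : DPoly n l k) : Prop :=
  ∀ u : DVar n l, leader g = u → ∀ θ : Fin n → ℕ, θ ≠ 0 → u.act θ ∉ f.vars

/-- `f` is reduced w.r.t. `g`. -/
def IsReduced (f g : DPoly n l k) : Prop :=
  IsPartiallyReduced f g ∧ ∀ u : DVar n l, leader g = u → degreeOf u f < degreeOf u g

/-- Autoreduced sets of nonconstant differential polynomials. -/
def IsAutoreduced (A : Set (DPoly n l k)) : Prop :=
  (∀ f ∈ A, f ∉ Set.range (C : k → DPoly n l k)) ∧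
    ∀ f ∈ A, ∀ g ∈ A, f ≠ g → IsReduced f g

/-- An autoreduced set `A_1, …, A_p`, given as the list of its elements in order of increasing
rank. By `IsAutoreduced.exists_list` every autoreduced set is given by such a list. -/
def IsAutoreducedList (A : List (DPoly n l k)) : Prop :=
  IsAutoreduced {f | f ∈ A} ∧ A.Pairwise fun f g => rank f < rank g

/-- `A` has lower rank than `B` (for autoreduced sets listed in order of increasing rank). -/
def HasLowerRank (A B : List (DPoly n l k)) : Prop :=
  (∃ (i : ℕ) (hA : i < A.length) (hB : i < B.length),
      (A.take i).map rank = (B.take i).map rank ∧ rank A[i] < rank B[i]) ∨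
    (B.length < A.length ∧ (A.take B.length).map rank = B.map rank)

/-- `H_A`: the product of the initials and the separants of the elements of `A`. -/
noncomputable def prodH (A : List (DPoly n l k)) : DPoly n l k :=
  (A.map initial).prod * (A.map separant).prod

/-- The ideal `[A] : H_A^∞`. -/
noncomputable def satIdeal (δ : Fin n → Derivation ℤ k k) (A : List (DPoly n l k)) :
    Ideal (DPoly n l k) :=
  saturate (diffIdeal δ {f | f ∈ A}) (Submonoid.powers (prodH A))

/-- `A` is a characteristic set (in Kolchin's sense) of the ideal `I`: an autoreduced set of the
lowest rank in `I`. -/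
def IsCharacteristicSet (A : List (DPoly n l k)) (I : Ideal (DPoly n l k)) : Prop :=
  IsAutoreducedList A ∧ (∀ f ∈ A, f ∈ I) ∧
    ∀ B : List (DPoly n l k), IsAutoreducedList B → (∀ f ∈ B, f ∈ I) → ¬ HasLowerRank B A

/-- `A` is a characterizing set of the differential ideal `I`. -/
def IsCharacterizingSet (δ : Fin n → Derivation ℤ k k) (A : List (DPoly n l k))
    (I : Ideal (DPoly n l k)) : Prop :=
  IsDifferentialIdeal δ I ∧ IsCharacteristicSet A I ∧ I = satIdeal δ A

theorem exists_leader {f : DPoly n l k} (hf : f ∉ Set.range (C : k → DPoly n l k)) :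
    ∃ u : DVar n l, leader f = u ∧ u ∈ f.vars ∧ leaderDegree f = degreeOf u f := by
  have h : f.vars.Nonempty := by
    rw [Finset.nonempty_iff_ne_empty]
    intro h0
    exact hf ⟨_, (vars_eq_empty_iff_eq_C.1 h0).symm⟩
  refine ⟨f.vars.max' h, (Finset.coe_max' h).symm, Finset.max'_mem _ h, ?_⟩
  rw [leaderDegree, dif_pos h]

theorem IsAutoreduced.not_act {S : Set (DPoly n l k)} (hS : IsAutoreduced S)
    {f g : DPoly n l k} (hf : f ∈ S) (hg : g ∈ S) (hfg : f ≠ g) {u v : DVar n l}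
    (hu : leader f = u) (hv : leader g = v) (θ : Fin n → ℕ) : u.act θ ≠ v := by
  intro h
  by_cases hθ : θ = 0
  · have huv : u = v := by rw [← h, hθ]; simp [DVar.act]
    subst huv
    exact lt_asymm ((hS.2 f hf g hg hfg).2 u hv) ((hS.2 g hg f hf hfg.symm).2 u hu)
  · obtain ⟨w, hw, hw', -⟩ := exists_leader (hS.1 g hg)
    have : w = v := WithBot.coe_injective (hw.symm.trans hv)
    subst this
    exact (hS.2 g hg f hf hfg.symm).1 u hu θ hθ (h ▸ hw')

/-- Every autoreduced set is finite. -/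
theorem IsAutoreduced.finite {S : Set (DPoly n l k)} (hS : IsAutoreduced S) : S.Finite := by
  by_contra hinf
  have hinf : S.Infinite := hinf
  let a : ℕ → S := hinf.natEmbedding
  have ha : Function.Injective a := hinf.natEmbedding.injective
  choose u hu using fun i => exists_leader (hS.1 (a i) (a i).2)
  have hw : WellQuasiOrdered (fun x y : Fin l × (Fin n → ℕ) => x.1 = y.1 ∧ x.2 ≤ y.2) :=
    WellQuasiOrdered.prod (r := fun x y : Fin l => x = y) (s := fun x y : Fin n → ℕ => x ≤ y)
      (Finite.wellQuasiOrdered _) wellQuasiOrdered_le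
  obtain ⟨i, j, hij, h1, h2⟩ := hw fun i => ((u i).idx, (u i).exp)
  refine hS.not_act (a i).2 (a j).2 ?_ (hu i).1 (hu j).1 ((u j).exp - (u i).exp) ?_
  · intro h
    exact hij.ne (ha (Subtype.ext h))
  · ext1
    · exact h1
    · exact tsub_add_cancel_of_le h2

/-- Every autoreduced set can be listed in order of increasing rank. -/
theorem IsAutoreduced.exists_list {S : Set (DPoly n l k)} (hS : IsAutoreduced S) :
    ∃ A : List (DPoly n l k), IsAutoreducedList A ∧ {f | f ∈ A} = S := by
  classical
  let L := hS.finite.toFinset.toList.insertionSort (fun f g => rank f ≤ rank g)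
  have hmem : {f | f ∈ L} = S := by ext f; simp [L]
  have hnd : L.Nodup :=
    (List.perm_insertionSort _ _).nodup_iff.2 (Finset.nodup_toList _)
  have : Std.Total (fun f g : DPoly n l k => rank f ≤ rank g) := ⟨fun f g => le_total _ _⟩
  have : IsTrans (DPoly n l k) (fun f g => rank f ≤ rank g) := ⟨fun _ _ _ => le_trans⟩
  have hs : L.Pairwise fun f g => rank f ≤ rank g := List.pairwise_insertionSort _ _
  refine ⟨L, ⟨hmem ▸ hS, ?_⟩, hmem⟩
  refine (hs.and hnd).imp_of_mem ?_
  rintro f g hf hg ⟨hle, hne⟩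
  refine lt_of_le_of_ne hle fun h => ?_
  have hf' : f ∈ S := hmem ▸ hf
  have hg' : g ∈ S := hmem ▸ hg
  obtain ⟨u, hu, -⟩ := exists_leader (hS.1 f hf')
  obtain ⟨v, hv, -⟩ := exists_leader (hS.1 g hg')
  have hl : leader f = leader g := congrArg (fun r => (ofLex r).1) h
  have huv : u = v := WithBot.coe_injective (hu.symm.trans (hl.trans hv))
  exact hS.not_act hf' hg' hne hu hv 0 (by rw [huv]; simp [DVar.act])

end Reduction

end DiffAlg

/-! If `A` lies in `J` and `B` in `I`, each list competes with the other for minimality, so neither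
has lower rank and the two sequences of ranks agree (`map_rank_eq_of_not_hasLowerRank`). By symmetry
it is enough to show `I ≤ J`.

Take `f ∈ I` and reduce it by Ritt's algorithm modulo `B` (`exists_remainder`): `s * f - r ∈ [B]`,
where `s` divides a power of `H_B` and `r` is reduced with respect to `B`. Since `[B] ≤ I`, also `r
∈ I`. Being reduced depends only on the rank of the divisor, so `r` is reduced with respect to `A`
as well, and minimality of `A` makes `r` constant (`IsCharacteristicSet.mem_range_C_of_isReduced`).
If `r = 0`, a power of `H_B` times `f` lies in `[B]`, so `f ∈ J`.

Constants are excluded from autoreduced sets, so a nonzero constant `r` is not contradictory by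
itself: it gives `I = ⊤`. The initials and separants of `A`, which are reduced with respect to `A`,
are then nonzero constants (`IsCharacteristicSet.isUnit_prodH`), whence `f ∈ [A] ≤ J`. -/

namespace DiffAlg

/-! ### Degrees and partial derivatives -/

section Degrees

variable {σ R : Type*} [CommRing R]

theorem degreeOf_pderiv_le (u w : σ) (f : MvPolynomial σ R) :
    degreeOf w (pderiv u f) ≤ degreeOf w f := by
  classical
  rw [degreeOf_le_iff]
  intro m hm
  rw [mem_support_iff, coeff_pderiv] at hm
  have h := (degreeOf_le_iff (n := w)).1 le_rfl _ (mem_support_iff.2 (left_ne_zero_of_mul hm))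
  rw [Finsupp.add_apply] at h
  omega

theorem degreeOf_pderiv_lt {u : σ} {f : MvPolynomial σ R} (h : 0 < degreeOf u f) :
    degreeOf u (pderiv u f) < degreeOf u f := by
  classical
  rw [degreeOf_lt_iff h]
  intro m hm
  rw [mem_support_iff, coeff_pderiv] at hm
  have h := (degreeOf_le_iff (n := u)).1 le_rfl _ (mem_support_iff.2 (left_ne_zero_of_mul hm))
  rw [Finsupp.add_apply, Finsupp.single_eq_same] at h
  omega

theorem exists_mem_support_eq_degreeOf {u : σ} {f : MvPolynomial σ R} (h : 0 < degreeOf u f) :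
    ∃ m ∈ f.support, m u = degreeOf u f := by
  by_contra! hne
  refine lt_irrefl _ ((degreeOf_lt_iff h).2 fun m hm => ?_)
  exact lt_of_le_of_ne (degreeOf_le_iff.1 le_rfl m hm) (hne m hm)

/-- A monomial containing `u` has its coefficient multiplied by its exponent at `u`, which is
nonzero in characteristic zero. This keeps separants from vanishing. -/
theorem pderiv_ne_zero [NoZeroDivisors R] [CharZero R] {u : σ} {f : MvPolynomial σ R}
    (h : 0 < degreeOf u f) : pderiv u f ≠ 0 := by
  obtain ⟨m, hm, hmu⟩ := exists_mem_support_eq_degreeOf h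
  have hle : Finsupp.single u 1 ≤ m := by
    rw [Finsupp.single_le_iff]
    omega
  obtain ⟨m', rfl⟩ := exists_add_of_le hle
  intro h0
  have hc := coeff_pderiv (i := u) f m'
  rw [h0, coeff_zero, add_comm m'] at hc
  exact mul_ne_zero (mem_support_iff.1 hm) (Nat.cast_add_one_ne_zero _) hc.symm

theorem degreeOf_eq_zero_of_mem_supported {s : Set σ} {f : MvPolynomial σ R}
    (hf : f ∈ supported R s) {w : σ} (hw : w ∉ s) : degreeOf w f = 0 := by
  by_contra h
  exact hw (mem_supported.1 hf (mem_vars_iff_degreeOf_ne_zero.2 h))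

end Degrees

/-! ### Generated differential ideals -/

section DiffIdeal

variable {n l : ℕ} {k : Type*} [CommRing k]

theorem subset_diffIdeal (δ : Fin n → Derivation ℤ k k) (F : Set (DPoly n l k)) :
    F ⊆ diffIdeal δ F := by
  intro f hf
  simp only [diffIdeal, SetLike.mem_coe, Ideal.mem_sInf]
  exact fun {I} hI => hI.2 hf

theorem isDifferentialIdeal_diffIdeal (δ : Fin n → Derivation ℤ k k) (F : Set (DPoly n l k)) :
    IsDifferentialIdeal δ (diffIdeal δ F) := by
  intro j f hf
  simp only [diffIdeal, Ideal.mem_sInf] at hf ⊢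
  exact fun {I} hI => hI.1 j f (hf hI)

theorem diffIdeal_le {δ : Fin n → Derivation ℤ k k} {F : Set (DPoly n l k)}
    {I : Ideal (DPoly n l k)} (hI : IsDifferentialIdeal δ I) (hF : F ⊆ I) : diffIdeal δ F ≤ I :=
  sInf_le ⟨hI, hF⟩

end DiffIdeal

/-! ### Rankings are strictly monotone well-orders -/

section Ranking

variable {n l : ℕ}

theorem DVar.act_zero (v : DVar n l) : v.act 0 = v := by simp [DVar.act]

theorem DVar.act_act (θ η : Fin n → ℕ) (v : DVar n l) : (v.act θ).act η = v.act (η + θ) := by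
  simp [DVar.act, add_assoc]

theorem DVar.act_injective (θ : Fin n → ℕ) : Function.Injective (DVar.act (l := l) θ) := by
  intro u v h
  have h1 := congrArg DVar.idx h
  have h2 := congrArg DVar.exp h
  exact DVar.ext h1 (add_left_cancel h2)

theorem DVar.act_ne_self {θ : Fin n → ℕ} (hθ : θ ≠ 0) (v : DVar n l) : v.act θ ≠ v := by
  intro h
  have h2 : θ + v.exp = v.exp := congrArg DVar.exp h
  exact hθ (by simpa using h2)

variable [LinearOrder (DVar n l)]

theorem IsRanking.lt_act (hr : IsRanking n l) {θ : Fin n → ℕ} (hθ : θ ≠ 0) (v : DVar n l) :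
    v < v.act θ :=
  lt_of_le_of_ne (hr.le_act θ v) (DVar.act_ne_self hθ v).symm

theorem IsRanking.act_lt_act (hr : IsRanking n l) (θ : Fin n → ℕ) {u v : DVar n l} (h : u < v) :
    u.act θ < v.act θ :=
  lt_of_le_of_ne (hr.act_le_act θ v u h.le) fun e => h.ne (DVar.act_injective θ e)

/-- A ranking is a well-order. -/
theorem IsRanking.wellFoundedLT (hr : IsRanking n l) : WellFoundedLT (DVar n l) := by
  have hw : WellQuasiOrdered (fun x y : Fin l × (Fin n → ℕ) => x.1 = y.1 ∧ x.2 ≤ y.2) :=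
    WellQuasiOrdered.prod (r := fun x y : Fin l => x = y) (s := fun x y : Fin n → ℕ => x ≤ y)
      (Finite.wellQuasiOrdered _) wellQuasiOrdered_le
  refine ⟨RelEmbedding.wellFounded_iff_isEmpty.2 ⟨fun f => ?_⟩⟩
  -- Dickson's lemma: in an infinite descending sequence some later term would be a derivative of an
  -- earlier one, hence not smaller.
  obtain ⟨i, j, hij, h1, h2⟩ := hw fun i => ((f i).idx, (f i).exp)
  have hlt : f j < f i := f.map_rel_iff.2 hij
  have hle : f i ≤ f j := by
    have := hr.le_act ((f j).exp - (f i).exp) (f i)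
    rwa [show (f i).act ((f j).exp - (f i).exp) = f j from
      DVar.ext h1 (tsub_add_cancel_of_le h2)] at this
  exact absurd hlt hle.not_gt

end Ranking

/-! ### Leading terms of derivatives -/

section Derivatives

variable {n l : ℕ} [LinearOrder (DVar n l)] {k : Type*} [CommRing k]

theorem polyDer_mem_supported_Iio (hr : IsRanking n l) (δ : Fin n → Derivation ℤ k k) (j : Fin n)
    {v : DVar n l} {p : DPoly n l k} (hp : p ∈ supported k (Set.Iio v)) :
    polyDer δ j p ∈ supported k (Set.Iio (v.act (Pi.single j 1))) := by
  have hle : supported k (Set.Iio v) ≤ supported k (Set.Iio (v.act (Pi.single j 1))) :=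
    supported_mono (Set.Iio_subset_Iio (hr.le_act _ _))
  rw [supported_eq_adjoin_X] at hp
  induction hp using Algebra.adjoin_induction with
  | mem x hx =>
    obtain ⟨w, hw, rfl⟩ := hx
    rw [polyDer_X]
    exact Algebra.subset_adjoin ⟨_, hr.act_lt_act _ hw, rfl⟩
  | algebraMap r =>
    rw [algebraMap_eq, polyDer_C]
    exact Subalgebra.algebraMap_mem _ _
  | add x y _ _ hx hy => rw [map_add]; exact add_mem hx hy
  | mul x y hx hy hx' hy' =>
    rw [← supported_eq_adjoin_X] at hx hy
    rw [Derivation.leibniz, smul_eq_mul, smul_eq_mul]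
    exact add_mem (mul_mem (hle hx) hy') (mul_mem (hle hy) hx')

/-- The derivative of a polynomial in the variables up to `u` is linear in the derivative of `u`. -/
theorem polyDer_sub_mem_supported_Iio (hr : IsRanking n l) (δ : Fin n → Derivation ℤ k k)
    (j : Fin n) {u : DVar n l} {p : DPoly n l k} (hp : p ∈ supported k (Set.Iic u)) :
    polyDer δ j p - pderiv u p * X (u.act (Pi.single j 1)) ∈
      supported k (Set.Iio (u.act (Pi.single j 1))) := by
  classical
  have hlt : u < u.act (Pi.single j 1) := hr.lt_act (by simp) u
  have hle : supported k (Set.Iic u) ≤ supported k (Set.Iio (u.act (Pi.single j 1))) :=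
    supported_mono fun w hw => lt_of_le_of_lt hw hlt
  rw [supported_eq_adjoin_X] at hp
  induction hp using Algebra.adjoin_induction with
  | mem x hx =>
    obtain ⟨w, hw, rfl⟩ := hx
    rw [polyDer_X]
    rcases eq_or_ne w u with rfl | hwu
    · simp
    · rw [pderiv_X_of_ne hwu, zero_mul, sub_zero]
      exact Algebra.subset_adjoin ⟨_, hr.act_lt_act _ (lt_of_le_of_ne hw hwu), rfl⟩
  | algebraMap r =>
    rw [algebraMap_eq, polyDer_C, pderiv_C, zero_mul, sub_zero]
    exact Subalgebra.algebraMap_mem _ _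
  | add x y _ _ hx hy =>
    rw [map_add, map_add]
    convert add_mem hx hy using 1
    ring
  | mul x y hx hy hx' hy' =>
    rw [← supported_eq_adjoin_X] at hx hy
    rw [Derivation.leibniz, Derivation.leibniz]
    simp only [smul_eq_mul]
    convert add_mem (mul_mem (hle hx) hy') (mul_mem (hle hy) hx') using 1
    ring

/-- A proper derivative `θ f` is `S_f θ u_f` plus a polynomial in lower variables. -/
theorem exists_derivative (hr : IsRanking n l) (δ : Fin n → Derivation ℤ k k)
    {I : Ideal (DPoly n l k)} (hI : IsDifferentialIdeal δ I) {f : DPoly n l k} (hf : f ∈ I)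
    {u : DVar n l} (hu : f ∈ supported k (Set.Iic u)) (θ : Fin n → ℕ) (hθ : θ ≠ 0) :
    ∃ g ∈ I, g - pderiv u f * X (u.act θ) ∈ supported k (Set.Iio (u.act θ)) := by
  -- Induction on the order of `θ`, splitting off one derivation `δ_j` at a time.
  induction hN : ∑ i, θ i generalizing θ with
  | zero => exact absurd (funext fun i => by simpa using (Finset.sum_eq_zero_iff.1 hN) i) hθ
  | succ N ih =>
    obtain ⟨j, hj⟩ := Function.ne_iff.1 hθ
    have hj1 : Pi.single j 1 ≤ θ := by
      intro i
      rcases eq_or_ne i j with rfl | h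
      · simpa using Nat.one_le_iff_ne_zero.2 hj
      · simp [h]
    obtain ⟨η, rfl⟩ := exists_add_of_le hj1
    rcases eq_or_ne η 0 with rfl | hη
    · rw [add_zero]
      exact ⟨_, hI j f hf, polyDer_sub_mem_supported_Iio hr δ j hu⟩
    · have hNη : ∑ i, η i = N := by
        simp only [Pi.add_apply, Finset.sum_add_distrib, Finset.sum_pi_single', Finset.mem_univ,
          if_true] at hN
        omega
      obtain ⟨g, hg, h⟩ := ih η hη hNη
      refine ⟨polyDer δ j g, hI j g hg, ?_⟩
      have h1 := polyDer_mem_supported_Iio hr δ j h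
      rw [map_sub, Derivation.leibniz, polyDer_X, DVar.act_act] at h1
      have hlt : u < u.act η := hr.lt_act hη u
      have hlt' : u.act η < u.act (Pi.single j 1 + η) := by
        rw [← DVar.act_act]
        exact hr.lt_act (by simp) _
      have hS : pderiv u f ∈ supported k (Set.Iic u) := by
        rw [mem_supported] at hu ⊢
        intro w hw
        refine hu ?_
        rw [Finset.mem_coe, mem_vars_iff_degreeOf_ne_zero] at hw ⊢
        have := degreeOf_pderiv_le u w f
        omega
      have hS' : polyDer δ j (pderiv u f) ∈ supported k (Set.Iio (u.act (Pi.single j 1 + η))) := by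
        rw [← DVar.act_act]
        exact polyDer_mem_supported_Iio hr δ j (supported_mono (fun w hw => lt_of_le_of_lt hw hlt) hS)
      have hX : (X (u.act η) : DPoly n l k) ∈ supported k (Set.Iio (u.act (Pi.single j 1 + η))) := by
        rw [supported_eq_adjoin_X]
        exact Algebra.subset_adjoin ⟨_, hlt', rfl⟩
      -- By Leibniz, differentiating `S_f * θu` also produces `θu * δ_j S_f`, which involves only
      -- variables below `δ_j θu`.
      convert add_mem h1 (mul_mem hX hS') using 1
      simp only [smul_eq_mul]
      ring

end Derivatives

/-! ### Coefficients in one variable and pseudo-division -/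

section CoeffIn

variable {n l : ℕ} {k : Type*} [CommRing k]

theorem degreeOf_sum_monomial_le {σ : Type*} (w : σ) (s : Finset (σ →₀ ℕ))
    (g : (σ →₀ ℕ) → σ →₀ ℕ) (c : (σ →₀ ℕ) → k) (d : ℕ) (h : ∀ m ∈ s, g m w ≤ d) :
    degreeOf w (∑ m ∈ s, monomial (g m) (c m)) ≤ d := by
  refine (degreeOf_sum_le _ _ _).trans (Finset.sup_le fun m hm => ?_)
  by_cases hc : c m = 0
  · simp [hc]
  · rw [degreeOf_monomial_eq _ _ hc]
    exact h m hm

theorem degreeOf_coeffIn_le (v w : DVar n l) (d : ℕ) (f : DPoly n l k) :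
    degreeOf w (coeffIn v d f) ≤ degreeOf w f := by
  classical
  refine degreeOf_sum_monomial_le _ _ _ _ _ fun m hm => ?_
  refine le_trans ?_ (degreeOf_le_iff.1 le_rfl m (Finset.mem_filter.1 hm).1)
  rw [Finsupp.erase_apply]
  split_ifs <;> simp

theorem degreeOf_coeffIn_self (v : DVar n l) (d : ℕ) (f : DPoly n l k) :
    degreeOf v (coeffIn v d f) = 0 := by
  classical
  exact Nat.le_zero.1 (degreeOf_sum_monomial_le _ _ _ _ _ fun m _ => by simp)

theorem coeffIn_mul_X_pow (v : DVar n l) (d : ℕ) (f : DPoly n l k) :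
    coeffIn v d f * X v ^ d = ∑ m ∈ f.support with m v = d, monomial m (coeff m f) := by
  classical
  rw [coeffIn, Finset.sum_mul]
  refine Finset.sum_congr rfl fun m hm => ?_
  rw [X_pow_eq_monomial, monomial_mul, mul_one, ← (Finset.mem_filter.1 hm).2,
    Finsupp.erase_add_single]

theorem degreeOf_sub_coeffIn_lt {v : DVar n l} {f : DPoly n l k} (h : 0 < degreeOf v f) :
    degreeOf v (f - coeffIn v (degreeOf v f) f * X v ^ degreeOf v f) < degreeOf v f := by
  classical
  have hsum : f - coeffIn v (degreeOf v f) f * X v ^ degreeOf v f =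
      ∑ m ∈ f.support with ¬ m v = degreeOf v f, monomial m (coeff m f) := by
    rw [coeffIn_mul_X_pow, sub_eq_iff_eq_add, add_comm, Finset.sum_filter_add_sum_filter_not]
    exact f.as_sum
  rw [hsum]
  refine Nat.lt_of_le_pred h (degreeOf_sum_monomial_le _ _ _ _ _ fun m hm => ?_)
  obtain ⟨hm, hne⟩ := Finset.mem_filter.1 hm
  exact Nat.le_pred_of_lt (lt_of_le_of_ne (degreeOf_le_iff.1 le_rfl m hm) hne)

theorem coeffIn_degreeOf_ne_zero {v : DVar n l} {f : DPoly n l k} (h : 0 < degreeOf v f) :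
    coeffIn v (degreeOf v f) f ≠ 0 := by
  intro h0
  have := degreeOf_sub_coeffIn_lt h
  rw [h0, zero_mul, sub_zero] at this
  exact lt_irrefl _ this

/-- One step of pseudo-division by `g = a v ^ d + t` with respect to the variable `v`. -/
theorem degreeOf_pseudoReduce_lt {v : DVar n l} {f g a : DPoly n l k} {d : ℕ} (hd : 0 < d)
    (hdf : d ≤ degreeOf v f) (ha : degreeOf v a = 0) (hg : degreeOf v (g - a * X v ^ d) < d) :
    degreeOf v (a * f - coeffIn v (degreeOf v f) f * X v ^ (degreeOf v f - d) * g) <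
      degreeOf v f := by
  classical
  cases subsingleton_or_nontrivial k
  · have : Subsingleton (DPoly n l k) := inferInstance
    rw [Subsingleton.elim f 0] at hdf
    simp at hdf
    omega
  have hf := degreeOf_sub_coeffIn_lt (hd.trans_le hdf)
  have hc := degreeOf_coeffIn_self v (degreeOf v f) f
  set e := degreeOf v f
  set c := coeffIn v e f
  have hX : degreeOf v (X v ^ (e - d) : DPoly n l k) ≤ e - d := by
    refine (degreeOf_pow_le _ _ _).trans ?_
    simp
  -- The terms in `v ^ e` cancel, leaving only the tails of `f` and `g`.
  have key : a * f - c * X v ^ (e - d) * g =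
      a * (f - c * X v ^ e) - c * X v ^ (e - d) * (g - a * X v ^ d) := by
    have : (X v ^ e : DPoly n l k) = X v ^ (e - d) * X v ^ d := by
      rw [← pow_add, Nat.sub_add_cancel hdf]
    rw [this]
    ring
  rw [key]
  refine (degreeOf_sub_le _ _ _).trans_lt (max_lt ?_ ?_)
  · exact (degreeOf_mul_le _ _ _).trans_lt (by omega)
  · refine (degreeOf_mul_le _ _ _).trans_lt ?_
    have := degreeOf_mul_le v c (X v ^ (e - d))
    omega

/-- Apart from `f` and its coefficient, all factors are free of `w`. Applied to variables above `v`,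
this makes Ritt reduction terminate. -/
theorem degreeOf_pseudoReduce_le {v w : DVar n l} (hvw : w ≠ v) (f : DPoly n l k)
    {g a : DPoly n l k} (ha : degreeOf w a = 0) (hg : degreeOf w g = 0) (d e : ℕ) :
    degreeOf w (a * f - coeffIn v d f * X v ^ e * g) ≤ degreeOf w f := by
  classical
  have hX : degreeOf w (X v ^ e : DPoly n l k) = 0 := by
    cases subsingleton_or_nontrivial k
    · have : Subsingleton (DPoly n l k) := inferInstance
      rw [Subsingleton.elim (X v ^ e : DPoly n l k) 0, degreeOf_zero]
    refine Nat.le_zero.1 ((degreeOf_pow_le _ _ _).trans ?_)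
    simp [degreeOf_X, hvw]
  have hc := degreeOf_coeffIn_le v w d f
  refine (degreeOf_sub_le _ _ _).trans (max_le ?_ ?_)
  · exact (degreeOf_mul_le _ _ _).trans (by omega)
  · refine (degreeOf_mul_le _ _ _).trans ?_
    have := degreeOf_mul_le w (coeffIn v d f) (X v ^ e)
    omega

end CoeffIn

/-! ### Leaders, initials and separants -/

section Leader

variable {n l : ℕ} [LinearOrder (DVar n l)] {k : Type*} [CommRing k]

theorem leader_eq_coe_iff {f : DPoly n l k} {u : DVar n l} :
    leader f = u ↔ u ∈ f.vars ∧ ∀ w ∈ f.vars, w ≤ u := by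
  constructor
  · exact fun h => ⟨Finset.mem_of_max h, fun w hw => Finset.le_max_of_eq hw h⟩
  · rintro ⟨h, hle⟩
    exact le_antisymm (Finset.max_le fun w hw => WithBot.coe_le_coe.2 (hle w hw))
      (Finset.le_max h)

theorem max'_vars_eq {f : DPoly n l k} {u : DVar n l} (h : leader f = u) (hne : f.vars.Nonempty) :
    f.vars.max' hne = u :=
  WithBot.coe_injective ((Finset.coe_max' hne).trans h)

theorem nonempty_vars_of_leader_eq {f : DPoly n l k} {u : DVar n l} (h : leader f = u) :
    f.vars.Nonempty :=
  ⟨u, (leader_eq_coe_iff.1 h).1⟩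

theorem leaderDegree_eq {f : DPoly n l k} {u : DVar n l} (h : leader f = u) :
    leaderDegree f = degreeOf u f := by
  rw [leaderDegree, dif_pos (nonempty_vars_of_leader_eq h), max'_vars_eq h]

theorem initial_eq {f : DPoly n l k} {u : DVar n l} (h : leader f = u) :
    initial f = coeffIn u (degreeOf u f) f := by
  rw [initial, dif_pos (nonempty_vars_of_leader_eq h), max'_vars_eq h, leaderDegree_eq h]

theorem separant_eq {f : DPoly n l k} {u : DVar n l} (h : leader f = u) :
    separant f = pderiv u f := by
  rw [separant, dif_pos (nonempty_vars_of_leader_eq h), max'_vars_eq h]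

theorem degreeOf_leader_pos {f : DPoly n l k} {u : DVar n l} (h : leader f = u) :
    0 < degreeOf u f :=
  Nat.pos_of_ne_zero (mem_vars_iff_degreeOf_ne_zero.1 (leader_eq_coe_iff.1 h).1)

theorem degreeOf_eq_zero_of_leader_lt {f : DPoly n l k} {u w : DVar n l} (h : leader f = u)
    (hw : u < w) : degreeOf w f = 0 := by
  by_contra hne
  exact ((leader_eq_coe_iff.1 h).2 w (mem_vars_iff_degreeOf_ne_zero.2 hne)).not_gt hw

theorem mem_supported_Iic_leader {f : DPoly n l k} {u : DVar n l} (h : leader f = u) :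
    f ∈ supported k (Set.Iic u) :=
  mem_supported.2 (leader_eq_coe_iff.1 h).2

end Leader

/-! ### Ritt reduction -/

section Reduction

variable {n l : ℕ} [LinearOrder (DVar n l)] {k : Type*} [CommRing k]

/-- The variable `w` witnesses that `f` is not reduced with respect to `a`. -/
def IsReducible (a f : DPoly n l k) (w : DVar n l) : Prop :=
  ∃ u : DVar n l, leader a = u ∧ ∃ θ : Fin n → ℕ, w = u.act θ ∧ w ∈ f.vars ∧
    (θ = 0 → degreeOf u a ≤ degreeOf u f)

theorem isReduced_of_forall_not_isReducible {a f : DPoly n l k} (h : ∀ w, ¬ IsReducible a f w) :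
    IsReduced f a := by
  refine ⟨fun u hu θ hθ hmem => h _ ⟨u, hu, θ, rfl, hmem, fun h0 => absurd h0 hθ⟩, ?_⟩
  intro u hu
  by_contra! hle
  refine h u ⟨u, hu, 0, u.act_zero.symm, ?_, fun _ => hle⟩
  rw [mem_vars_iff_degreeOf_ne_zero]
  have := degreeOf_leader_pos hu
  omega

/-- Both conditions on `f` are monotone in its degree in `w`. Hence eliminating at one variable
creates no new reducible variable above it. -/
theorem IsReducible.of_degreeOf_le {a f g : DPoly n l k} {w : DVar n l} (h : IsReducible a f w)
    (hle : degreeOf w f ≤ degreeOf w g) : IsReducible a g w := by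
  obtain ⟨u, hu, θ, rfl, hw, hθ⟩ := h
  refine ⟨u, hu, θ, rfl, ?_, ?_⟩
  · rw [mem_vars_iff_degreeOf_ne_zero] at hw ⊢
    omega
  · rintro rfl
    rw [DVar.act_zero] at hle
    exact (hθ rfl).trans hle

/-- If `f` is not reduced with respect to `a` in the variable `w`, a multiple of `f` by the initial
or the separant of `a` can be replaced by a polynomial of lower degree in `w`. -/
theorem IsReducible.exists_reduction (hr : IsRanking n l) (δ : Fin n → Derivation ℤ k k)
    {I : Ideal (DPoly n l k)} (hI : IsDifferentialIdeal δ I) {a f : DPoly n l k} (haI : a ∈ I)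
    {w : DVar n l} (h : IsReducible a f w) :
    ∃ s f' : DPoly n l k, (s = initial a ∨ s = separant a) ∧ s * f - f' ∈ I ∧
      degreeOf w f' < degreeOf w f ∧ ∀ v, w < v → degreeOf v f' ≤ degreeOf v f := by
  obtain ⟨u, hu, θ, rfl, hw, hθ⟩ := h
  -- Both cases are pseudo-division by some `g = s * w ^ d + (lower in w)`: for `θ = 0`, `g` is `a`
  -- and `s` its initial; otherwise `g` is a derivative of `a`, `s` the separant and `d = 1`.
  suffices H : ∃ s g : DPoly n l k, ∃ d : ℕ, (s = initial a ∨ s = separant a) ∧ g ∈ I ∧ 0 < d ∧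
      d ≤ degreeOf (u.act θ) f ∧ degreeOf (u.act θ) s = 0 ∧
      degreeOf (u.act θ) (g - s * X (u.act θ) ^ d) < d ∧
      (∀ v, u.act θ < v → degreeOf v s = 0) ∧ ∀ v, u.act θ < v → degreeOf v g = 0 by
    obtain ⟨s, g, d, hs, hg, hd, hdf, hs0, hg0, hsv, hgv⟩ := H
    refine ⟨s, _, hs, ?_, degreeOf_pseudoReduce_lt hd hdf hs0 hg0,
      fun v hv => degreeOf_pseudoReduce_le hv.ne' f (hsv v hv) (hgv v hv) _ _⟩
    rw [sub_sub_cancel]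
    exact I.mul_mem_left _ hg
  have hpos := degreeOf_leader_pos hu
  rcases eq_or_ne θ 0 with rfl | hθ0
  · rw [DVar.act_zero] at hw ⊢
    have hI0 := initial_eq hu
    refine ⟨initial a, a, degreeOf u a, Or.inl rfl, haI, hpos, hθ rfl, ?_, ?_, ?_, ?_⟩
    · rw [hI0, degreeOf_coeffIn_self]
    · rw [hI0]
      exact degreeOf_sub_coeffIn_lt hpos
    · intro v hv
      rw [hI0]
      have := degreeOf_coeffIn_le u v (degreeOf u a) a
      have := degreeOf_eq_zero_of_leader_lt hu hv
      omega
    · exact fun v hv => degreeOf_eq_zero_of_leader_lt hu hv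
  · have hlt := hr.lt_act hθ0 u
    obtain ⟨g, hg, hsub⟩ := exists_derivative hr δ hI haI (mem_supported_Iic_leader hu) θ hθ0
    have hS : ∀ v, u < v → degreeOf v (pderiv u a) = 0 := by
      intro v hv
      have := degreeOf_pderiv_le u v a
      have := degreeOf_eq_zero_of_leader_lt hu hv
      omega
    refine ⟨pderiv u a, g, 1, Or.inr (separant_eq hu).symm, hg, one_pos, ?_, hS _ hlt, ?_,
      fun v hv => hS v (hlt.trans hv), ?_⟩
    · rw [mem_vars_iff_degreeOf_ne_zero] at hw
      omega
    · rw [pow_one, degreeOf_eq_zero_of_mem_supported hsub (by simp)]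
      exact one_pos
    · intro v hv
      have hmem : g ∈ supported k (Set.Iic (u.act θ)) := by
        have hX : (X (u.act θ) : DPoly n l k) ∈ supported k (Set.Iic (u.act θ)) := by
          rw [supported_eq_adjoin_X]
          exact Algebra.subset_adjoin ⟨_, le_refl (u.act θ), rfl⟩
        have hS' : pderiv u a ∈ supported k (Set.Iic (u.act θ)) := by
          rw [mem_supported]
          intro x hx
          rw [Finset.mem_coe, mem_vars_iff_degreeOf_ne_zero] at hx
          exact not_lt.1 fun hlt' => hx (hS x (hlt.trans hlt'))
        rw [← sub_add_cancel g (pderiv u a * X (u.act θ))]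
        exact add_mem (supported_mono Set.Iio_subset_Iic_self hsub) (mul_mem hS' hX)
      exact degreeOf_eq_zero_of_mem_supported hmem (by simpa using hv)

theorem initial_dvd_prodH {A : List (DPoly n l k)} {a : DPoly n l k} (ha : a ∈ A) :
    initial a ∣ prodH A :=
  (List.dvd_prod (List.mem_map_of_mem ha)).mul_right _

theorem separant_dvd_prodH {A : List (DPoly n l k)} {a : DPoly n l k} (ha : a ∈ A) :
    separant a ∣ prodH A :=
  (List.dvd_prod (List.mem_map_of_mem ha)).mul_left _

/-- Ritt's reduction of `f` with respect to the polynomials of the list `A`. -/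
theorem exists_remainder (hr : IsRanking n l) (δ : Fin n → Derivation ℤ k k)
    {I : Ideal (DPoly n l k)} (hI : IsDifferentialIdeal δ I) {A : List (DPoly n l k)}
    (hA : ∀ a ∈ A, a ∈ I) (f : DPoly n l k) :
    ∃ (s r : DPoly n l k) (m : ℕ), s ∣ prodH A ^ m ∧ s * f - r ∈ I ∧ ∀ a ∈ A, IsReduced r a := by
  classical
  have := hr.wellFoundedLT
  -- Well-founded induction on a strict bound `p` for the pairs (reducible variable, degree of `f`
  -- in it), ordered lexicographically.
  have key : ∀ p : DVar n l ×ₗ ℕ, ∀ f : DPoly n l k,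
      (∀ a ∈ A, ∀ w, IsReducible a f w → toLex (w, degreeOf w f) < p) →
      ∃ (s r : DPoly n l k) (m : ℕ), s ∣ prodH A ^ m ∧ s * f - r ∈ I ∧
        ∀ a ∈ A, IsReduced r a := by
    intro p
    induction p using WellFoundedLT.induction with
    | ind p ih =>
      intro f hf
      set W := f.vars.filter fun w => ∃ a ∈ A, IsReducible a f w
      rcases W.eq_empty_or_nonempty with hW | hW
      · refine ⟨1, f, 0, one_dvd _, by simp, fun a ha => ?_⟩
        refine isReduced_of_forall_not_isReducible fun w hw => ?_
        have hwv : w ∈ f.vars := by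
          obtain ⟨_, _, _, _, h, _⟩ := hw
          exact h
        exact Finset.notMem_empty w (hW ▸ Finset.mem_filter.2 ⟨hwv, a, ha, hw⟩)
      · obtain ⟨-, a, ha, hv⟩ := Finset.mem_filter.1 (W.max'_mem hW)
        set v := W.max' hW
        obtain ⟨s, f', hs, hsf, hlt, hle⟩ := hv.exists_reduction hr δ hI (hA a ha)
        obtain ⟨s', r, m, hdvd, hmem, hred⟩ := ih _ (hf a ha v hv) f' fun b hb w hw => by
          rw [Prod.Lex.toLex_lt_toLex]
          rcases lt_trichotomy w v with h | h | h
          · exact Or.inl h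
          · exact Or.inr ⟨h, h ▸ hlt⟩
          -- A reducible variable of `f'` above `v` would already be one of `f`, against the choice
          -- of `v` as the highest.
          · have hwf := hw.of_degreeOf_le (hle w h)
            have hwv : w ∈ f.vars := by
              obtain ⟨_, _, _, _, h, _⟩ := hwf
              exact h
            exact absurd (W.le_max' w (Finset.mem_filter.2 ⟨hwv, b, hb, hwf⟩)) h.not_ge
        refine ⟨s' * s, r, m + 1, ?_, ?_, hred⟩
        · rw [pow_succ]
          refine mul_dvd_mul hdvd ?_
          rcases hs with rfl | rfl
          exacts [initial_dvd_prodH ha, separant_dvd_prodH ha]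
        · convert I.add_mem (I.mul_mem_left s' hsf) hmem using 1
          ring
  rcases f.vars.eq_empty_or_nonempty with h | h
  · refine ⟨1, f, 0, one_dvd _, by simp, fun a _ => ?_⟩
    refine isReduced_of_forall_not_isReducible fun w hw => ?_
    obtain ⟨_, _, _, _, h', _⟩ := hw
    simp [h] at h'
  -- The added one makes the bound strict at the leader itself.
  · refine key (toLex (f.vars.max' h, degreeOf (f.vars.max' h) f + 1)) f fun a _ w hw => ?_
    have hwv : w ∈ f.vars := by
      obtain ⟨_, _, _, _, h, _⟩ := hw
      exact h
    rw [Prod.Lex.toLex_lt_toLex]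
    rcases (f.vars.le_max' w hwv).lt_or_eq with h' | h'
    · exact Or.inl h'
    · exact Or.inr ⟨h', by rw [← h']; exact Nat.lt_succ_self _⟩

end Reduction

/-! ### Ranks and reducedness -/

section Rank

variable {n l : ℕ} [LinearOrder (DVar n l)] {k : Type*} [CommRing k]

theorem leader_eq_of_rank_eq {f g : DPoly n l k} (h : rank f = rank g) : leader f = leader g :=
  congrArg (fun r => (ofLex r).1) h

theorem IsReduced.of_rank_eq {f a b : DPoly n l k} (h : IsReduced f a) (hab : rank a = rank b) :
    IsReduced f b := by
  have hl := leader_eq_of_rank_eq hab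
  refine ⟨fun u hu => h.1 u (hl.trans hu), fun u hu => ?_⟩
  have hd : leaderDegree a = leaderDegree b := congrArg (fun r => (ofLex r).2) hab
  rw [← leaderDegree_eq hu, ← hd, leaderDegree_eq (hl.trans hu)]
  exact h.2 u (hl.trans hu)

theorem IsReduced.of_degreeOf_le {f g a : DPoly n l k} (h : IsReduced f a)
    (hle : ∀ w, degreeOf w g ≤ degreeOf w f) : IsReduced g a := by
  refine ⟨fun u hu θ hθ hmem => h.1 u hu θ hθ ?_, fun u hu => (hle u).trans_lt (h.2 u hu)⟩
  rw [mem_vars_iff_degreeOf_ne_zero] at hmem ⊢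
  have := hle (u.act θ)
  omega

theorem isReduced_of_degreeOf_le_of_lt (hr : IsRanking n l) {f g : DPoly n l k} {u : DVar n l}
    (hu : leader f = u) (hle : ∀ w, degreeOf w g ≤ degreeOf w f)
    (hlt : degreeOf u g < degreeOf u f) : IsReduced g f := by
  refine ⟨fun v hv θ hθ hmem => ?_, fun v hv => ?_⟩ <;>
    obtain rfl : u = v := WithBot.coe_injective (hu.symm.trans hv)
  · rw [mem_vars_iff_degreeOf_ne_zero] at hmem
    have := hle (u.act θ)
    have := degreeOf_eq_zero_of_leader_lt hu (hr.lt_act hθ u)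
    omega
  · exact hlt

/-- Proper derivatives of the leader of `f` exceed that leader, hence every variable of `g`. -/
theorem isReduced_of_rank_lt (hr : IsRanking n l) {f g : DPoly n l k} {v : DVar n l}
    (hv : leader g = v) (h : rank g < rank f) : IsReduced g f := by
  rw [rank, rank, Prod.Lex.toLex_lt_toLex] at h
  refine ⟨fun u hu θ hθ hmem => ?_, fun u hu => ?_⟩
  · have h1 : u.act θ ≤ v := (leader_eq_coe_iff.1 hv).2 _ hmem
    have h2 : leader g ≤ leader f := h.elim le_of_lt fun h => h.1.le
    rw [hv, hu, WithBot.coe_le_coe] at h2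
    exact (hr.lt_act hθ u).not_ge (h1.trans h2)
  · rcases h with h | ⟨h, hd⟩
    · rw [hv, hu, WithBot.coe_lt_coe] at h
      rw [degreeOf_eq_zero_of_leader_lt hv h]
      exact degreeOf_leader_pos hu
    · rwa [leaderDegree_eq hu, leaderDegree_eq (h.trans hu)] at hd

theorem exists_append_rank {A : List (DPoly n l k)} (hA : A.Pairwise fun f g => rank f < rank g)
    (ρ : WithBot (DVar n l) ×ₗ ℕ) :
    ∃ P Q : List (DPoly n l k), A = P ++ Q ∧ (∀ a ∈ P, rank a < ρ) ∧ ∀ a ∈ Q, ρ ≤ rank a := by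
  induction A with
  | nil => exact ⟨[], [], rfl, by simp, by simp⟩
  | cons a A ih =>
    rw [List.pairwise_cons] at hA
    rcases lt_or_ge (rank a) ρ with h | h
    · obtain ⟨P, Q, rfl, hP, hQ⟩ := ih hA.2
      exact ⟨a :: P, Q, rfl, by simpa [h] using hP, hQ⟩
    · refine ⟨[], a :: A, rfl, by simp, fun b hb => ?_⟩
      rcases List.mem_cons.1 hb with rfl | hb
      exacts [h, h.trans (hA.1 b hb).le]

theorem HasLowerRank.cons {a b : DPoly n l k} (hab : rank a = rank b) {A B : List (DPoly n l k)}
    (h : HasLowerRank A B) : HasLowerRank (a :: A) (b :: B) := by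
  rcases h with ⟨i, hA, hB, h1, h2⟩ | ⟨h1, h2⟩
  · exact Or.inl ⟨i + 1, by simpa using hA, by simpa using hB, by simp [hab, h1], by simpa using h2⟩
  · exact Or.inr ⟨by simpa using h1, by simp [hab, h2]⟩

/-- Lists of polynomials are totally preordered by their ranks. -/
theorem map_rank_eq_of_not_hasLowerRank {A B : List (DPoly n l k)} (h : ¬ HasLowerRank A B)
    (h' : ¬ HasLowerRank B A) : A.map rank = B.map rank := by
  induction A generalizing B with
  | nil =>
    cases B with
    | nil => rfl
    | cons b B => exact absurd (Or.inr ⟨by simp, by simp⟩) h'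
  | cons a A ih =>
    cases B with
    | nil => exact absurd (Or.inr ⟨by simp, by simp⟩) h
    | cons b B =>
      rcases lt_trichotomy (rank a) (rank b) with hab | hab | hab
      · exact absurd (Or.inl ⟨0, by simp, by simp, by simp, hab⟩) h
      · rw [List.map_cons, List.map_cons, hab,
          ih (fun hl => h (hl.cons hab)) fun hl => h' (hl.cons hab.symm)]
      · exact absurd (Or.inl ⟨0, by simp, by simp, by simp, hab⟩) h'

end Rank

/-! ### Reduced elements and minimality -/

section CharacteristicSet

variable {n l : ℕ} [LinearOrder (DVar n l)] {k : Type*} [CommRing k]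

/-- An element of an ideal that is reduced with respect to a characteristic set is constant. -/
theorem IsCharacteristicSet.mem_range_C_of_isReduced (hr : IsRanking n l)
    {A : List (DPoly n l k)} {I : Ideal (DPoly n l k)} (hA : IsCharacteristicSet A I)
    {f : DPoly n l k} (hf : f ∈ I) (hred : ∀ a ∈ A, IsReduced f a) :
    f ∈ Set.range (C : k → DPoly n l k) := by
  by_contra hfC
  obtain ⟨u, hu, -⟩ := exists_leader hfC
  obtain ⟨⟨⟨hAC, hAred⟩, hsort⟩, hAI, hmin⟩ := hA
  -- Replacing the elements of rank at least that of `f` by `f` itself gives an autoreduced list in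
  -- `I` that contradicts minimality.
  obtain ⟨P, Q, rfl, hP, hQ⟩ := exists_append_rank hsort (rank f)
  have hlead : ∀ a ∈ P, ∃ v : DVar n l, leader a = v := fun a ha =>
    let ⟨v, hv, _⟩ := exists_leader (hAC a (List.mem_append_left Q ha))
    ⟨v, hv⟩
  refine hmin (P ++ [f]) ⟨⟨?_, ?_⟩, ?_⟩ ?_ ?_
  · rintro g hg
    rcases List.mem_append.1 hg with hg | hg
    · exact hAC g (List.mem_append_left Q hg)
    · rwa [List.mem_singleton.1 hg]
  · rintro g hg h hh hgh
    rcases List.mem_append.1 hg with hg | hg <;> rcases List.mem_append.1 hh with hh | hh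
    · exact hAred g (List.mem_append_left Q hg) h (List.mem_append_left Q hh) hgh
    · obtain ⟨v, hv⟩ := hlead g hg
      rw [List.mem_singleton.1 hh]
      exact isReduced_of_rank_lt hr hv (hP g hg)
    · rw [List.mem_singleton.1 hg]
      exact hred h (List.mem_append_left Q hh)
    · exact absurd ((List.mem_singleton.1 hg).trans (List.mem_singleton.1 hh).symm) hgh
  · rw [List.pairwise_append]
    refine ⟨(List.pairwise_append.1 hsort).1, List.pairwise_singleton _ _, fun a ha b hb => ?_⟩
    rw [List.mem_singleton.1 hb]
    exact hP a ha
  · intro g hg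
    rcases List.mem_append.1 hg with hg | hg
    · exact hAI g (List.mem_append_left Q hg)
    · rwa [List.mem_singleton.1 hg]
  -- If `Q` is empty the new list properly extends `A`; otherwise the ranks first differ at `f`,
  -- equality being impossible because `f` is reduced with respect to `q`.
  · cases Q with
    | nil => exact Or.inr ⟨by simp, by simp⟩
    | cons q Q =>
      refine Or.inl ⟨P.length, by simp, by simp, by simp, ?_⟩
      simp only [List.getElem_append_right le_rfl, Nat.sub_self,
        List.getElem_cons_zero]
      refine lt_of_le_of_ne (hQ q (by simp)) fun he => ?_
      have h := ((hred q (by simp)).of_rank_eq he.symm).2 u hu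
      exact lt_irrefl _ h

end CharacteristicSet

/-! ### The unit ideal and the inclusion of ideals -/

section Field

variable {n l : ℕ} [LinearOrder (DVar n l)] {k : Type*} [Field k] [CharZero k]

/-- If a characteristic set of the unit ideal exists, its initials and separants are units. -/
theorem IsCharacteristicSet.isUnit_prodH (hr : IsRanking n l) {A : List (DPoly n l k)}
    (hA : IsCharacteristicSet A (⊤ : Ideal (DPoly n l k))) : IsUnit (prodH A) := by
  -- Such a `g` inherits reducedness from `a` with respect to the other elements, and is reduced
  -- with respect to `a` by the drop in the leader. Lying in the unit ideal, it must be constant.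
  have key : ∀ a ∈ A, ∀ u : DVar n l, leader a = u → ∀ g : DPoly n l k, g ≠ 0 →
      (∀ w, degreeOf w g ≤ degreeOf w a) → degreeOf u g < degreeOf u a → IsUnit g := by
    intro a ha u hu g hg hle hlt
    obtain ⟨c, rfl⟩ := hA.mem_range_C_of_isReduced hr (f := g) trivial fun b hb => by
      by_cases hab : a = b
      · exact hab ▸ isReduced_of_degreeOf_le_of_lt hr hu hle hlt
      · exact (hA.1.1.2 a ha b hb hab).of_degreeOf_le hle
    refine (isUnit_iff_ne_zero.2 fun hc => hg ?_).map C
    rw [hc, C_0]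
  refine IsUnit.mul ?_ ?_ <;> refine List.prod_isUnit fun g hg => ?_ <;>
    obtain ⟨a, ha, rfl⟩ := List.mem_map.1 hg <;>
    obtain ⟨u, hu, -⟩ := exists_leader (hA.1.1.1 a ha) <;>
    have hpos := degreeOf_leader_pos hu
  · rw [initial_eq hu]
    refine key a ha u hu _ (coeffIn_degreeOf_ne_zero hpos) (fun w => degreeOf_coeffIn_le _ _ _ _) ?_
    rwa [degreeOf_coeffIn_self]
  · rw [separant_eq hu]
    exact key a ha u hu _ (pderiv_ne_zero hpos) (fun w => degreeOf_pderiv_le _ _ _)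
      (degreeOf_pderiv_lt hpos)

theorem IsCharacterizingSet.le_of_subset (hr : IsRanking n l) {δ : Fin n → Derivation ℤ k k}
    {A B : List (DPoly n l k)} {I J : Ideal (DPoly n l k)} (hA : IsCharacterizingSet δ A I)
    (hB : IsCharacterizingSet δ B J) (hAJ : ∀ f ∈ A, f ∈ J) (hBI : ∀ f ∈ B, f ∈ I) : I ≤ J := by
  obtain ⟨hI, hAI, hIA⟩ := hA
  obtain ⟨hJ, hBJ, hJB⟩ := hB
  have hrank : A.map rank = B.map rank :=
    map_rank_eq_of_not_hasLowerRank (hBJ.2.2 A hAI.1 hAJ) (hAI.2.2 B hBJ.1 hBI)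
  intro f hf
  -- Reducing modulo `[B]` rather than `J` matters: `[B]` is known to lie in `I`, so the remainder
  -- stays in `I`.
  obtain ⟨s, r, m, ⟨t, ht⟩, hsr, hred⟩ := exists_remainder hr δ
    (isDifferentialIdeal_diffIdeal δ {b | b ∈ B}) (fun b hb => subset_diffIdeal δ _ hb) f
  have hrI : r ∈ I := by
    rw [← sub_sub_cancel (s * f) r]
    exact I.sub_mem (I.mul_mem_left _ hf) (diffIdeal_le hI hBI hsr)
  obtain ⟨c, rfl⟩ := hAI.mem_range_C_of_isReduced hr hrI fun a ha => by
    obtain ⟨b, hb, hba⟩ := List.mem_map.1 (hrank ▸ List.mem_map_of_mem (f := rank) ha)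
    exact (hred b hb).of_rank_eq hba
  by_cases hc : c = 0
  · rw [hc, C_0, sub_zero] at hsr
    rw [hJB]
    refine ⟨prodH B ^ m, ⟨m, rfl⟩, ?_⟩
    rw [ht, mul_right_comm]
    exact Ideal.mul_mem_right _ _ hsr
  · have hItop : I = ⊤ := Ideal.eq_top_of_isUnit_mem I hrI ((isUnit_iff_ne_zero.2 hc).map C)
    have hunit : IsUnit (prodH A) := (hItop ▸ hAI).isUnit_prodH hr
    rw [hIA] at hf
    obtain ⟨_, ⟨m, rfl⟩, hmf⟩ := hf
    exact diffIdeal_le hJ hAJ ((Ideal.unit_mul_mem_iff_mem _ (hunit.pow m)).1 hmf)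

end Field

end DiffAlg

theorem mainTheorem11 {n l : ℕ} [LinearOrder (DiffAlg.DVar n l)]
    (hrank : DiffAlg.IsRanking n l) {k : Type*} [Field k] [CharZero k]
    (δ : Fin n → Derivation ℤ k k) (hδ : ∀ i j a, δ i (δ j a) = δ j (δ i a))
    (A B : List (DiffAlg.DPoly n l k)) (I J : Ideal (DiffAlg.DPoly n l k))
    (hA : DiffAlg.IsCharacterizingSet δ A I) (hB : DiffAlg.IsCharacterizingSet δ B J) :
    I = J ↔ (∀ f ∈ A, f ∈ J) ∧ (∀ f ∈ B, f ∈ I) := by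
  constructor
  · rintro rfl
    exact ⟨hA.2.1.2.1, hB.2.1.2.1⟩
  · rintro ⟨hAJ, hBI⟩
    exact le_antisymm (hA.le_of_subset hrank hB hAJ hBI) (hB.le_of_subset hrank hA hBI hAJ)
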